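/- Let $\mathcal{A}$ be a finite set of actions, let $Q$ be a probability distribution on $[0,1]$, and let $(\bar q^{(k)})_{k\ge 1}$ be an increasing deterministic sequence in $[0,1]$ with $\bar q^{(k)}\to 1$. For each $k$, the $k$-th modulated Bernoulli bandit is a reward process $R^{(k)}=(R^{(k)}_{t,a})_{t\ge 1,\,a\in\mathcal{A}}$ of the following kind. Independently across actions $a$, the mean rewards $(\theta^{(k)}_{t,a})_{t\ge1}$ start with $\theta^{(k)}_{1,a}\sim Q$, and at each later timestep the mean reward is redrawn from $Q$ with probability $\bar q^{(k)}$, independently of everything before, and is otherwise left unchanged. Conditionally on all mean rewards, the rewards $R^{(k)}_{t,a}$ are independent with $R^{(k)}_{t,a}\sim\mathrm{Bernoulli}(\theta^{(k)}_{t,a})$. Let $(f_t)_{t\ge 1}$ be any sequence of deterministic (measurable) functions, put $\alpha^{(k)}_t=f_t(R^{(k)}_t)$ with $R^{(k)}_t=(R^{(k)}_{t,a})_{a\in\mathcal A}$, and for $T\ge 1$ let $$V_T^{(k)}(\alpha)=\sum_{t=0}^{T-1}\mathbb{I}\left(\alpha^{(k)}_{t+2:\infty};\,R^{(k)}_{t+1}\,\middle|\,R^{(k)}_{1:t}\right)$$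 be the cumulative predictive information, where $\mathbb I(\cdot\,;\cdot\,|\,\cdot)$ is conditional mutual information. Let $\mathbb{H}(Q)=\mathbb{E}_{\theta\sim Q}[-\log Q(\{\theta\})]\in[0,\infty]$ be the Shannon entropy of $Q$ (so $\mathbb{H}(Q)=\infty$ if $Q$ is not purely atomic). Then, for all $k$ and $T$, $$V_T^{(k)}(\alpha)\le T\,|\mathcal{A}|\,\bigl(1-\bar q^{(k)}\bigr)\,\mathbb{H}(Q),$$ with the convention $0\cdot\infty=0$. If $\mathbb{H}(Q)<\infty$, this bound tends to $0$ as $k\to\infty$. For every $Q$, finite entropy or not, $V_T^{(k)}(\alpha)\to 0$ as $k\to\infty$. -/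

import Mathlib

open MeasureTheory ProbabilityTheory InformationTheory Filter Topology
open scoped ENNReal unitInterval

/-! Timesteps `1, 2, 3, …` are indexed by `0, 1, 2, …`: a process `X` with `X i` in Lean stands for
`X_{i+1}`. All information quantities are in nats and take values in `[0, ∞]`. -/

noncomputable section

namespace ModulatedBandit

/-- The Shannon entropy `ℍ(Q) = 𝔼[-log Q({θ})]`, `θ ∼ Q`, of a probability distribution on `[0, 1]`.
It equals `∑ x, Q({x}) log (1 / Q({x}))` when `Q` is purely atomic; since `-log 0 = ∞`, it is `∞`
when `Q` is not purely atomic. -/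
def entropy (Q : Measure I) : ℝ≥0∞ :=
  ∫⁻ x, (-ENNReal.log (Q {x})).toENNReal ∂Q

/-- The conditional mutual information `𝕀(X; Y | Z)`: the Kullback–Leibler divergence of the joint law
of `(Z, X, Y)` from `P_Z ⊗ (P_{X|Z} × P_{Y|Z}) = P_{(Z, X)} ⊗ P_{Y|Z}`, the law under which `X` and `Y`
are conditionally independent given `Z` while the laws of `(Z, X)` and `(Z, Y)` are kept.
The second form needs no regular conditional law of `X`, so `X` may live in any measurable space. -/
def condMutualInfo {Ω 𝓧 𝓨 𝓩 : Type*} [MeasurableSpace Ω] [MeasurableSpace 𝓧]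
    [MeasurableSpace 𝓨] [StandardBorelSpace 𝓨] [Nonempty 𝓨] [MeasurableSpace 𝓩]
    (μ : Measure Ω) [IsFiniteMeasure μ] (X : Ω → 𝓧) (Y : Ω → 𝓨) (Z : Ω → 𝓩) : ℝ≥0∞ :=
  klDiv (μ.map fun ω => ((Z ω, X ω), Y ω))
    ((μ.map fun ω => (Z ω, X ω)) ⊗ₘ Kernel.prodMkRight 𝓧 (condDistrib Y Z μ))

/-- Incremental predictive information `Δ_t(α) = 𝕀(α_{t+2:∞}; R_{t+1} | R_{1:t})`. -/
def incrementalPredictiveInfo {Ω A : Type*} [MeasurableSpace Ω] [Fintype A]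
    {E : ℕ → Type*} [∀ t, MeasurableSpace (E t)] (μ : Measure Ω) [IsFiniteMeasure μ]
    (α : ∀ t, Ω → E t) (R : ℕ → Ω → A → ℝ) (t : ℕ) : ℝ≥0∞ :=
  condMutualInfo μ (fun ω (i : ℕ) => α (t + 1 + i) ω) (R t) (fun ω (i : Fin t) => R i ω)

/-- Cumulative predictive information `V_T(α) = ∑_{t=0}^{T-1} Δ_t(α)`. -/
def cumulativePredictiveInfo {Ω A : Type*} [MeasurableSpace Ω] [Fintype A]
    {E : ℕ → Type*} [∀ t, MeasurableSpace (E t)] (μ : Measure Ω) [IsFiniteMeasure μ]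
    (α : ∀ t, Ω → E t) (R : ℕ → Ω → A → ℝ) (T : ℕ) : ℝ≥0∞ :=
  ∑ t ∈ Finset.range T, incrementalPredictiveInfo μ α R t

/-- The joint law of the independent random variables that drive a modulated Bernoulli bandit: for each
timestep `t` and action `a`, a fresh mean reward with law `ν a`, a coin that says with
probability `q a` to redraw, and a uniform variable on `[0, 1]` that generates the reward. -/
def drivingLaw {A : Type*} (ν : A → Measure I) [∀ a, IsProbabilityMeasure (ν a)] (q : A → I) :
    Measure (ℕ × A → I × Bool × I) :=
  Measure.infinitePi fun p : ℕ × A =>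
    (ν p.2).prod ((bernoulliMeasure true false (q p.2)).prod volume)

/-- Mean rewards: drawn at the first timestep; at each later one, replaced by the fresh draw if the
coin says so, and left unchanged otherwise. -/
def meanReward {A : Type*} (w : ℕ × A → I × Bool × I) : ℕ → A → I
  | 0, a => (w (0, a)).1
  | t + 1, a => if (w (t + 1, a)).2.1 = true then (w (t + 1, a)).1 else meanReward w t a

/-- Rewards: given the mean rewards, independent Bernoulli variables with these means. -/
def reward {A : Type*} (w : ℕ × A → I × Bool × I) (t : ℕ) (a : A) : ℝ :=
  if (w (t, a)).2.2 < meanReward w t a then 1 else 0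

/-- `R`, with mean rewards `θ`, is a modulated Bernoulli bandit with initial mean reward
distributions `ν a` and redraw probabilities `q a`. Only the joint law of `(θ, R)` matters; the
driving variables need not exist on the given probability space. -/
structure IsModulatedBernoulliBandit {Ω A : Type*} [MeasurableSpace Ω] (μ : Measure Ω)
    (θ : ℕ → Ω → A → I) (R : ℕ → Ω → A → ℝ)
    (ν : A → Measure I) [∀ a, IsProbabilityMeasure (ν a)] (q : A → I) : Prop where
  measurable_mean : ∀ t, Measurable (θ t)
  measurable_reward : ∀ t, Measurable (R t)
  law : μ.map (fun ω (t : ℕ) (a : A) => (θ t ω a, R t ω a)) =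
    (drivingLaw ν q).map (fun w (t : ℕ) (a : A) => (meanReward w t a, reward w t a))

end ModulatedBandit

end

/-! ### Divergence and conditional information bounds -/

namespace ModulatedBandit

/-! Since 𝕀(X; Y | Z) ≤ 𝕀(X; (Z, Y)) (`condMutualInfo_le`), it suffices to bound the information
between later rewards and the rewards so far. Later rewards are a function of `restart`, which
consists of the later driving variables and, for each action that is not redrawn, the current mean.
The later driving variables are independent of the past, so information passes only through the
retained means (`incrementalPredictiveInfo_le`).

The divergence is bounded by exhibiting a density bound `g` and averaging the positive part of `log
g` (`klDiv_le_lintegral_log`). With the coins fixed, two choices of `g` work. The inverse masses of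
the retained means give 𝔼[number retained] · ℍ(Q) = |A|(1 - q)ℍ(Q) (`klDiv_restart_le_entropy`). The
inverse mass of the reward history, used only when some mean is retained, gives |A|(1 - q) times a
bound on the entropy of finitely many binary rewards (`klDiv_restart_le_card`). The latter is finite
for every `Q`, whence the limit without an entropy hypothesis. -/

lemma ofReal_klFun_add_le {h g : ℝ≥0∞} (hg : h ≤ g) (hh : h ≠ ∞) :
    ENNReal.ofReal (klFun h.toReal) + h ≤ h * (ENNReal.log g).toENNReal + 1 := by
  rcases eq_or_ne h 0 with rfl | h0
  · simp [klFun_zero]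
  rcases eq_or_ne g ∞ with rfl | hgt
  · simp [ENNReal.mul_top h0]
  have hg0 : g ≠ 0 := fun e => h0 (by simpa [e] using hg)
  have hpos : 0 < h.toReal := ENNReal.toReal_pos h0 hh
  have hle : h.toReal ≤ g.toReal := ENNReal.toReal_mono hgt hg
  rw [ENNReal.log_pos_real hg0 hgt, EReal.toENNReal_of_ne_top (EReal.coe_ne_top _), EReal.toReal_coe]
  nth_rw 2 3 [← ENNReal.ofReal_toReal hh]
  rw [← ENNReal.ofReal_add (klFun_nonneg hpos.le) hpos.le, ← ENNReal.ofReal_mul hpos.le,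
    ← ENNReal.ofReal_one]
  -- `klFun h + h = h log h + 1`; truncation at `0` leaves the positive part of `log g`.
  refine le_trans (ENNReal.ofReal_le_ofReal ?_) ENNReal.ofReal_add_le
  have := mul_le_mul_of_nonneg_left (Real.log_le_log hpos hle) hpos.le
  rw [klFun_apply]
  linarith

/-- A bound on the density of `μ` with respect to `ν` gives a bound on the divergence. -/
lemma klDiv_le_lintegral_log {α : Type*} [MeasurableSpace α] {μ ν : Measure α}
    [IsProbabilityMeasure μ] [IsProbabilityMeasure ν] {g : α → ℝ≥0∞} (hg : Measurable g)
    (hle : μ ≤ ν.withDensity g) :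
    klDiv μ ν ≤ ∫⁻ x, (ENNReal.log (g x)).toENNReal ∂μ := by
  have hac : μ ≪ ν := (Measure.absolutelyContinuous_of_le hle).trans
    (withDensity_absolutelyContinuous ν g)
  have hrn : μ.rnDeriv ν ≤ᵐ[ν] g := by
    refine ae_le_of_forall_setLIntegral_le_of_sigmaFinite (Measure.measurable_rnDeriv _ _)
      fun s hs _ => ?_
    rw [Measure.setLIntegral_rnDeriv hac, ← withDensity_apply _ hs]
    exact hle s
  rw [klDiv_eq_lintegral_klFun_of_ac hac]
  have hmeas : Measurable fun x => (ENNReal.log (g x)).toENNReal := by fun_prop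
  -- The added density and the added `1` both integrate to `1`, so they cancel.
  have key : ∫⁻ x, (ENNReal.ofReal (klFun (μ.rnDeriv ν x).toReal) + μ.rnDeriv ν x) ∂ν ≤
      ∫⁻ x, (μ.rnDeriv ν x * (ENNReal.log (g x)).toENNReal + 1) ∂ν := by
    refine lintegral_mono_ae ?_
    filter_upwards [hrn, Measure.rnDeriv_ne_top μ ν] with x hx hx'
    exact ofReal_klFun_add_le hx hx'
  rw [lintegral_add_right _ (Measure.measurable_rnDeriv _ _), lintegral_add_right _ measurable_const,
    Measure.lintegral_rnDeriv hac, lintegral_rnDeriv_mul hac hmeas.aemeasurable] at key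
  simp only [lintegral_const, measure_univ, mul_one] at key
  exact (ENNReal.add_le_add_iff_right ENNReal.one_ne_top).1 key

/-- `𝕀(X; Y | Z) ≤ 𝕀(X; (Z, Y))`. -/
lemma condMutualInfo_le {Ω 𝓧 𝓨 𝓩 : Type*} [MeasurableSpace Ω] [MeasurableSpace 𝓧]
    [MeasurableSpace 𝓨] [StandardBorelSpace 𝓨] [Nonempty 𝓨] [MeasurableSpace 𝓩]
    (μ : Measure Ω) [IsProbabilityMeasure μ] {X : Ω → 𝓧} {Y : Ω → 𝓨} {Z : Ω → 𝓩}
    (hX : Measurable X) (hY : Measurable Y) (hZ : Measurable Z) :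
    condMutualInfo μ X Y Z ≤ klDiv (μ.map fun ω => (X ω, (Z ω, Y ω)))
      ((μ.map X).prod (μ.map fun ω => (Z ω, Y ω))) := by
  have := Measure.isProbabilityMeasure_map (μ := μ) hX.aemeasurable
  have := Measure.isProbabilityMeasure_map (μ := μ) hZ.aemeasurable
  have := Measure.isProbabilityMeasure_map (μ := μ) (hZ.prodMk hX).aemeasurable
  have := Measure.isProbabilityMeasure_map (μ := μ) (hZ.prodMk hY).aemeasurable
  have := Measure.isProbabilityMeasure_map (μ := μ) (hX.prodMk (hZ.prodMk hY)).aemeasurable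
  let r : 𝓧 × (𝓩 × 𝓨) → (𝓩 × 𝓧) × 𝓨 := fun p => ((p.2.1, p.1), p.2.2)
  have hr : Measurable r := by fun_prop
  have hJ : (μ.map fun ω => ((Z ω, X ω), Y ω)) =
      (μ.map fun ω => (X ω, (Z ω, Y ω))).map r := by
    rw [Measure.map_map hr (by fun_prop)]; rfl
  have hP : ((μ.map Z).prod (μ.map X)) ⊗ₘ Kernel.prodMkRight 𝓧 (condDistrib Y Z μ) =
      ((μ.map X).prod (μ.map fun ω => (Z ω, Y ω))).map r := by
    rw [← compProd_map_condDistrib hY.aemeasurable]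
    ext s hs
    have hf : Measurable (s.indicator (1 : (𝓩 × 𝓧) × 𝓨 → ℝ≥0∞)) := measurable_one.indicator hs
    rw [← lintegral_indicator_one hs, ← lintegral_indicator_one hs, lintegral_map hf hr,
      Measure.lintegral_compProd hf, lintegral_prod_symm _ hf.lintegral_kernel_prod_right'.aemeasurable,
      lintegral_prod _ (by fun_prop)]
    refine lintegral_congr fun x => ?_
    rw [Measure.lintegral_compProd (by fun_prop)]
    rfl
  have hC : (μ.map fun ω => ((Z ω, X ω), Y ω)) =
      (μ.map fun ω => (Z ω, X ω)) ⊗ₘ condDistrib Y (fun ω => (Z ω, X ω)) μ :=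
    (compProd_map_condDistrib hY.aemeasurable).symm
  calc condMutualInfo μ X Y Z
      ≤ klDiv (μ.map fun ω => ((Z ω, X ω), Y ω))
        (((μ.map Z).prod (μ.map X)) ⊗ₘ Kernel.prodMkRight 𝓧 (condDistrib Y Z μ)) := by
        rw [condMutualInfo, hC]
        -- Chain rule; the dropped term is 𝕀(X; Z).
        exact le_add_self.trans_eq (klDiv_compProd_eq_add _ _ _ _).symm
    _ ≤ _ := by
        rw [hJ, hP]
        exact klDiv_map_le _ _ hr

lemma measurable_measure_singleton {α : Type*} [MeasurableSpace α] [MeasurableEq α]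
    (ν : Measure α) [SFinite ν] : Measurable fun x => ν {x} := by
  have := measurable_measure_prodMk_left (ν := ν) (measurableSet_diagonal (α := α))
  convert this using 3 with x
  ext y
  simp [eq_comm]

/-- If `S = s(Θ, U)` with `U` independent of `(Θ, N)`, and for fixed `u` the joint law of
`(s(Θ, u), N)` is dominated by `g` times the product law, then `𝕀(S; N) ≤ 𝔼 (log g(S, N))⁺`. -/
lemma klDiv_map_prod_le {𝓣 𝓤 𝓢 𝓥 : Type*} [MeasurableSpace 𝓣] [MeasurableSpace 𝓤]
    [MeasurableSpace 𝓢] [MeasurableSpace 𝓥] (π : Measure (𝓣 × 𝓥)) [IsProbabilityMeasure π]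
    (P : Measure 𝓤) [IsProbabilityMeasure P] {s : 𝓣 → 𝓤 → 𝓢}
    (hs : Measurable (Function.uncurry s)) {g : 𝓢 × 𝓥 → ℝ≥0∞} (hg : Measurable g)
    (hdom : ∀ᵐ u ∂P, ∀ f : 𝓢 × 𝓥 → ℝ≥0∞, Measurable f →
      ∫⁻ p, f (s p.1 u, p.2) ∂π ≤
        ∫⁻ p, ∫⁻ p', f (s p'.1 u, p.2) * g (s p'.1 u, p.2) ∂π ∂π) :
    klDiv ((π.prod P).map fun x => (s x.1.1 x.2, x.1.2))
      (((π.prod P).map fun x => s x.1.1 x.2).prod (π.map Prod.snd)) ≤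
      ∫⁻ u, ∫⁻ p, (ENNReal.log (g (s p.1 u, p.2))).toENNReal ∂π ∂P := by
  have hs1 : Measurable fun x : (𝓣 × 𝓥) × 𝓤 => s x.1.1 x.2 :=
    hs.comp (measurable_fst.fst.prodMk measurable_snd)
  have hs2 : Measurable fun x : (𝓣 × 𝓥) × 𝓤 => (s x.1.1 x.2, x.1.2) := by fun_prop
  have := Measure.isProbabilityMeasure_map (μ := π.prod P) hs1.aemeasurable
  have := Measure.isProbabilityMeasure_map (μ := π.prod P) hs2.aemeasurable
  have := Measure.isProbabilityMeasure_map (μ := π) measurable_snd.aemeasurable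
  refine (klDiv_le_lintegral_log hg (Measure.le_iff.2 fun E hE => ?_)).trans_eq ?_
  · have hf : Measurable (E.indicator (1 : 𝓢 × 𝓥 → ℝ≥0∞)) := measurable_one.indicator hE
    have hfs : Measurable fun x : (𝓣 × 𝓥) × 𝓤 =>
        E.indicator (1 : 𝓢 × 𝓥 → ℝ≥0∞) (s x.1.1 x.2, x.1.2) := hf.comp hs2
    rw [withDensity_apply _ hE, ← lintegral_indicator_one hE, ← lintegral_indicator hE,
      lintegral_map hf hs2, lintegral_prod_symm' _ hfs,
      lintegral_prod_symm' _ (hg.indicator hE), lintegral_map (by fun_prop) measurable_snd]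
    have e : ∀ p : 𝓣 × 𝓥, ∫⁻ y, E.indicator g (y, p.2) ∂(π.prod P).map (fun x => s x.1.1 x.2) =
        ∫⁻ u, ∫⁻ p', E.indicator 1 (s p'.1 u, p.2) * g (s p'.1 u, p.2) ∂π ∂P := by
      intro p
      have hm : Measurable fun y => E.indicator g (y, p.2) := by fun_prop
      have hms : Measurable fun x : (𝓣 × 𝓥) × 𝓤 => E.indicator g (s x.1.1 x.2, p.2) :=
        hm.comp hs1
      rw [lintegral_map hm hs1, lintegral_prod_symm' _ hms]
      refine lintegral_congr fun u => lintegral_congr fun p' => ?_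
      by_cases h : (s p'.1 u, p.2) ∈ E <;> simp [h]
    simp_rw [e]
    -- The law of `N` does not depend on `u`, so both sides are averages over `u` and can be
    -- compared for each `u`.
    rw [lintegral_lintegral_swap (f := fun (p : 𝓣 × 𝓥) (u : 𝓤) =>
      ∫⁻ p', E.indicator 1 (s p'.1 u, p.2) * g (s p'.1 u, p.2) ∂π)]
    · refine lintegral_mono_ae ?_
      filter_upwards [hdom] with u hu
      exact hu _ hf
    · have : Measurable fun z : ((𝓣 × 𝓥) × 𝓤) × (𝓣 × 𝓥) => (s z.2.1 z.1.2, z.1.1.2) :=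
        (hs.comp (measurable_snd.fst.prodMk measurable_fst.snd)).prodMk measurable_fst.fst.snd
      exact ((hf.comp this).mul (hg.comp this)).lintegral_prod_right'.aemeasurable
  · have hl : Measurable fun x => (ENNReal.log (g x)).toENNReal := by fun_prop
    have hls : Measurable fun x : (𝓣 × 𝓥) × 𝓤 =>
        (ENNReal.log (g (s x.1.1 x.2, x.1.2))).toENNReal := hl.comp hs2
    rw [lintegral_map hl hs2, lintegral_prod_symm' _ hls]

/-! ### Restarting the bandit -/

variable {A : Type*}

/-- The driving variables of a bandit that restarts with mean rewards `m` just before the coins of the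
first timestep of `u` are tossed. -/
noncomputable def restart (m : A → I) (u : ℕ → A → I × Bool × I) (p : ℕ × A) : I × Bool × I :=
  if p.1 = 0 ∧ (u 0 p.2).2.1 = false then (m p.2, (u 0 p.2).2) else u p.1 p.2

/-- A redrawn action forgets its old mean; this is where information is lost. -/
lemma restart_eq {m m' : A → I} {u : ℕ → A → I × Bool × I}
    (h : ∀ a, (u 0 a).2.1 = false → m a = m' a) : restart m u = restart m' u := by
  funext p
  unfold restart
  split_ifs with hp
  · rw [h _ hp.2]
  · rfl

/-- The coins remain readable after restarting, so a density bound on restarted variables may depend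
on them. -/
lemma restart_coin (m : A → I) (u : ℕ → A → I × Bool × I) (a : A) :
    (restart m u (0, a)).2.1 = (u 0 a).2.1 := by
  simp only [restart]
  split_ifs <;> rfl

lemma restart_mean {m : A → I} {u : ℕ → A → I × Bool × I} {a : A} (h : (u 0 a).2.1 = false) :
    (restart m u (0, a)).1 = m a := by
  simp [restart, h]

lemma measurable_restart :
    Measurable (Function.uncurry (restart : (A → I) → (ℕ → A → I × Bool × I) → _)) := by
  refine measurable_pi_lambda _ fun p => ?_
  simp only [Function.uncurry, restart]
  refine Measurable.ite ?_ (by fun_prop) (by fun_prop)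
  by_cases h : p.1 = 0 <;> simp only [h, true_and, false_and, Set.ofPred_false, MeasurableSet.empty]
  exact measurableSet_eq_fun (by fun_prop) measurable_const

lemma measurableSet_coin (a : A) :
    MeasurableSet {u : ℕ → A → I × Bool × I | (u 0 a).2.1 = false} :=
  measurableSet_eq_fun (by fun_prop) measurable_const

lemma toENNReal_log_prod_le {ι : Type*} (s : Finset ι) (c : ι → ℝ≥0∞) :
    (ENNReal.log (∏ a ∈ s, c a)).toENNReal ≤ ∑ a ∈ s, (ENNReal.log (c a)).toENNReal := by
  classical
  induction s using Finset.induction_on with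
  | empty => simp
  | insert a s ha ih =>
    rw [Finset.prod_insert ha, Finset.sum_insert ha, ENNReal.log_mul_add]
    exact EReal.toENNReal_add_le.trans (add_le_add_right ih _)

lemma measurable_neg_log_singleton {α : Type*} [MeasurableSpace α] [MeasurableEq α]
    (ν : Measure α) [SFinite ν] : Measurable fun x => (-ENNReal.log (ν {x})).toENNReal := by
  have : Measurable fun y : ℝ≥0∞ => (-ENNReal.log y).toENNReal := by
    simp_rw [← ENNReal.log_inv]
    fun_prop
  exact this.comp (measurable_measure_singleton ν)

lemma ae_singleton_ne_zero {Q : Measure I} [SFinite Q] (h : entropy Q ≠ ∞) : ∀ᵐ x ∂Q, Q {x} ≠ 0 := by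
  have hm := measurable_neg_log_singleton Q
  filter_upwards [ae_lt_top hm h] with x hx h0
  simp [h0] at hx

/-! ### Information between the restarted variables and the past -/

section
variable [Fintype A] {𝓥 : Type*} [MeasurableSpace 𝓥]
  (π : Measure ((A → I) × 𝓥)) [IsProbabilityMeasure π]
  (P : Measure (ℕ → A → I × Bool × I)) [IsProbabilityMeasure P] {c : ℝ≥0∞}

lemma klDiv_restart_le_entropy {Q : Measure I} [IsProbabilityMeasure Q]
    (hπ : π.map Prod.fst = Measure.pi fun _ => Q)
    (hP : ∀ a, P {u | (u 0 a).2.1 = false} = c) :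
    klDiv ((π.prod P).map fun x => (restart x.1.1 x.2, x.1.2))
      (((π.prod P).map fun x => restart x.1.1 x.2).prod (π.map Prod.snd)) ≤
      Fintype.card A * c * entropy Q := by
  classical
  rcases eq_or_ne (Fintype.card A * c * entropy Q) ∞ with htop | htop
  · rw [htop]; exact le_top
  have hQ1 : Measurable fun x => Q {x} := measurable_measure_singleton Q
  have hmarg : ∀ a, π.map (fun p => p.1 a) = Q := fun a => by
    have : (fun p : (A → I) × 𝓥 => p.1 a) = Function.eval a ∘ Prod.fst := rfl
    rw [this, ← Measure.map_map (measurable_pi_apply a) measurable_fst, hπ]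
    exact (measurePreserving_eval (fun _ : A => Q) a).map_eq
  -- With the bound finite, either ℍ(Q) is finite, so `Q` is purely atomic, or no mean is ever
  -- retained.
  have hpos : ∀ᵐ u ∂P, ∀ᵐ p ∂π, ∀ a, (u 0 a).2.1 = true ∨ Q {p.1 a} ≠ 0 := by
    by_cases hH : entropy Q = ∞
    · have hc : ∀ᵐ u ∂P, ∀ a, (u 0 a).2.1 = true := by
        rw [ae_all_iff]
        intro a
        have : c = 0 := by
          have : Nonempty A := ⟨a⟩
          by_contra h0
          exact htop (by rw [hH, ENNReal.mul_top]; simp [h0])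
        rw [ae_iff]
        simpa [this] using hP a
      filter_upwards [hc] with u hu
      exact ae_of_all _ fun p a => Or.inl (hu a)
    · have : ∀ᵐ p ∂π, ∀ a, Q {p.1 a} ≠ 0 := by
        rw [ae_all_iff]
        intro a
        have h := ae_singleton_ne_zero hH
        rw [← hmarg a] at h
        have h2 := ae_of_ae_map (by fun_prop) h
        rwa [hmarg a] at h2
      exact ae_of_all _ fun u => this.mono fun p hp a => Or.inr (hp a)
  let g : (ℕ × A → I × Bool × I) × 𝓥 → ℝ≥0∞ := fun x =>
    ∏ a, if (x.1 (0, a)).2.1 = false then (Q {(x.1 (0, a)).1})⁻¹ else 1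
  have hg : Measurable g := by
    refine Finset.measurable_prod _ fun a _ => Measurable.ite
      (measurableSet_eq_fun (by fun_prop) measurable_const) ?_ measurable_const
    exact (hQ1.comp (by fun_prop : Measurable fun x : (ℕ × A → I × Bool × I) × 𝓥 =>
      (x.1 (0, a)).1)).inv
  have hgr : ∀ m u n, g (restart m u, n) =
      ∏ a, if (u 0 a).2.1 = false then (Q {m a})⁻¹ else 1 := by
    intro m u n
    refine Finset.prod_congr rfl fun a _ => ?_
    simp only [restart_coin]
    split_ifs with h
    · rw [restart_mean h]
    · rfl
  refine (klDiv_map_prod_le π P measurable_restart hg ?_).trans ?_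
  · filter_upwards [hpos] with u hu f hf
    refine lintegral_mono_ae ?_
    filter_upwards [hu] with p hp
    -- `V` is the event that an independent copy agrees with `p` on every retained mean. There the
    -- restarted variables coincide, and its mass is `1 / g`.
    let B : A → Set I := fun a => if (u 0 a).2.1 = false then {p.1 a} else Set.univ
    let V : Set ((A → I) × 𝓥) := Prod.fst ⁻¹' Set.univ.pi B
    have hB : ∀ a, MeasurableSet (B a) := fun a => by
      simp only [B]; split_ifs
      exacts [measurableSet_singleton _, MeasurableSet.univ]
    have hVm : MeasurableSet V := measurable_fst (MeasurableSet.univ_pi hB)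
    have hV : π V = ∏ a, if (u 0 a).2.1 = false then Q {p.1 a} else 1 := by
      rw [← Measure.map_apply measurable_fst (MeasurableSet.univ_pi hB), hπ, Measure.pi_pi]
      refine Finset.prod_congr rfl fun a _ => ?_
      simp only [B]; split_ifs <;> simp
    have hgV : g (restart p.1 u, p.2) * π V = 1 := by
      rw [hgr, hV, ← Finset.prod_mul_distrib]
      refine Finset.prod_eq_one fun a _ => ?_
      split_ifs with h
      · have : Q {p.1 a} ≠ 0 := (hp a).resolve_left (by simp [h])
        exact ENNReal.inv_mul_cancel this (measure_ne_top _ _)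
      · simp
    calc f (restart p.1 u, p.2)
        = ∫⁻ _ in V, f (restart p.1 u, p.2) * g (restart p.1 u, p.2) ∂π := by
          rw [setLIntegral_const, mul_assoc, hgV, mul_one]
      _ = ∫⁻ p' in V, f (restart p'.1 u, p.2) * g (restart p'.1 u, p.2) ∂π := by
          refine setLIntegral_congr_fun hVm fun p' hp' => ?_
          have : restart p.1 u = restart p'.1 u := restart_eq fun a ha => by
            have := hp' a (Set.mem_univ a)
            simp only [B, ha, if_true] at this
            exact this.symm
          simp only [this]
      _ ≤ _ := setLIntegral_le_lintegral _ _
  · have hm := measurable_neg_log_singleton Q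
    have hH : ∀ a, ∫⁻ p, (-ENNReal.log (Q {p.1 a})).toENNReal ∂π = entropy Q := fun a => by
      have := lintegral_map (μ := π) hm (by fun_prop : Measurable fun p => p.1 a)
      rw [hmarg a] at this
      exact this.symm
    calc ∫⁻ u, ∫⁻ p, (ENNReal.log (g (restart p.1 u, p.2))).toENNReal ∂π ∂P
        ≤ ∫⁻ u, ∑ a, {u : ℕ → A → I × Bool × I | (u 0 a).2.1 = false}.indicator
            (fun _ => entropy Q) u ∂P := by
          refine lintegral_mono fun u => ?_
          calc ∫⁻ p, (ENNReal.log (g (restart p.1 u, p.2))).toENNReal ∂π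
              ≤ ∫⁻ p, ∑ a, (if (u 0 a).2.1 = false then
                  (-ENNReal.log (Q {p.1 a})).toENNReal else 0) ∂π := by
                refine lintegral_mono fun p => ?_
                simp only [hgr]
                refine (toENNReal_log_prod_le _ _).trans (Finset.sum_le_sum fun a _ => ?_)
                split_ifs
                · rw [ENNReal.log_inv]
                · simp
            _ = _ := by
                rw [lintegral_finsetSum]
                · refine Finset.sum_congr rfl fun a _ => ?_
                  by_cases h : (u 0 a).2.1 = false <;> simp [h, hH]
                · intro a _
                  split_ifs
                  exacts [hm.comp (by fun_prop : Measurable fun p : (A → I) × 𝓥 => p.1 a),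
                    measurable_const]
      _ = Fintype.card A * c * entropy Q := by
          rw [lintegral_finsetSum _ fun a _ => measurable_const.indicator (measurableSet_coin a)]
          simp_rw [lintegral_indicator_const (measurableSet_coin _), hP]
          simp [mul_assoc, mul_comm c]

/-- Each atom contributes `-x log x ≤ 1 - x ≤ 1`. This is cruder than `log F.card`, but only
finiteness matters. -/
lemma lintegral_neg_log_le_card {F : Finset 𝓥} [MeasurableSingletonClass 𝓥] (ρ : Measure 𝓥)
    [IsProbabilityMeasure ρ] (hF : ρ (F : Set 𝓥)ᶜ = 0) :
    ∫⁻ n, (-ENNReal.log (ρ {n})).toENNReal ∂ρ ≤ F.card := by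
  have hr : ρ.restrict (F : Set 𝓥) = ρ := Measure.restrict_eq_self_of_ae_mem (by
    rw [ae_iff]; exact hF)
  rw [← hr, lintegral_finset, hr, ← nsmul_one F.card]
  refine Finset.sum_le_card_nsmul _ _ _ fun n _ => ?_
  rcases eq_or_ne (ρ {n}) 0 with h0 | h0
  · simp [h0]
  have hpos : 0 < (ρ {n}).toReal := ENNReal.toReal_pos h0 (measure_ne_top _ _)
  rw [ENNReal.log_pos_real h0 (measure_ne_top _ _), ← EReal.coe_neg,
    EReal.toENNReal_of_ne_top (EReal.coe_ne_top _), EReal.toReal_coe]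
  nth_rw 2 [← ENNReal.ofReal_toReal (measure_ne_top ρ {n})]
  rw [mul_comm, ← ENNReal.ofReal_mul hpos.le, ← ENNReal.ofReal_one]
  refine ENNReal.ofReal_le_ofReal ?_
  have h1 := Real.one_sub_inv_le_log_of_pos hpos
  have h2 := mul_le_mul_of_nonneg_left h1 hpos.le
  rw [mul_sub, mul_inv_cancel₀ hpos.ne'] at h2
  nlinarith

lemma klDiv_restart_le_card [MeasurableEq 𝓥] [MeasurableSingletonClass 𝓥] {F : Finset 𝓥}
    (hF : π (Prod.snd ⁻¹' (F : Set 𝓥)ᶜ) = 0)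
    (hP : ∀ a, P {u | (u 0 a).2.1 = false} = c) :
    klDiv ((π.prod P).map fun x => (restart x.1.1 x.2, x.1.2))
      (((π.prod P).map fun x => restart x.1.1 x.2).prod (π.map Prod.snd)) ≤
      Fintype.card A * c * F.card := by
  classical
  have := Measure.isProbabilityMeasure_map (μ := π) measurable_snd.aemeasurable
  set ρ : Measure 𝓥 := π.map Prod.snd with hρ
  have hFm : MeasurableSet (F : Set 𝓥)ᶜ := F.measurableSet.compl
  have hρF : ρ (F : Set 𝓥)ᶜ = 0 := by rw [hρ, Measure.map_apply measurable_snd hFm, hF]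
  have hρ1 : Measurable fun n => ρ {n} := measurable_measure_singleton ρ
  have hpos : ∀ᵐ p ∂π, ρ {p.2} ≠ 0 := by
    refine ae_of_ae_map (f := Prod.snd) (p := fun n => ρ {n} ≠ 0) measurable_snd.aemeasurable ?_
    rw [← hρ, ae_iff]
    refine measure_mono_null (t := (F : Set 𝓥)ᶜ ∪ ⋃ n ∈ F.filter (fun n => ρ {n} = 0), {n}) ?_ ?_
    · intro n hn
      by_cases h : n ∈ F <;> simp_all
    · refine measure_union_null hρF ((measure_biUnion_null_iff (Finset.countable_toSet _)).2 ?_)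
      intro n hn
      simpa using (Finset.mem_filter.1 hn).2
  let C : Set (ℕ × A → I × Bool × I) := {w | ∀ a, (w (0, a)).2.1 = true}
  have hC : MeasurableSet C := by
    simp only [C, Set.ofPred_forall]
    exact MeasurableSet.iInter fun a => measurableSet_eq_fun (by fun_prop) measurable_const
  let g : (ℕ × A → I × Bool × I) × 𝓥 → ℝ≥0∞ := fun x => if x.1 ∈ C then 1 else (ρ {x.2})⁻¹
  have hg : Measurable g :=
    Measurable.ite (measurable_fst hC) measurable_const (hρ1.comp measurable_snd).inv
  have hgC : ∀ m u, restart m u ∈ C ↔ ∀ a, (u 0 a).2.1 = true := fun m u => by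
    simp only [C, Set.mem_ofPred_eq, restart_coin]
  have hr : ∀ u, Measurable fun p : (A → I) × 𝓥 => restart p.1 u := fun u =>
    measurable_restart.comp (measurable_fst.prodMk measurable_const)
  refine (klDiv_map_prod_le π P measurable_restart hg (ae_of_all _ fun u f hf => ?_)).trans ?_
  · by_cases hu : ∀ a, (u 0 a).2.1 = true
    · refine lintegral_mono fun p => ?_
      have : ∀ p' : (A → I) × 𝓥, restart p'.1 u = restart p.1 u := fun p' =>
        restart_eq fun a ha => by simp [hu a] at ha
      simp only [this, g, (hgC _ _).2 hu, if_true, mul_one, lintegral_const, measure_univ, le_refl]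
    -- After the swap the restarted variables are held fixed, and the inner integral is cut down to
    -- the atom of the observed history.
    · rw [lintegral_lintegral_swap]
      · refine lintegral_mono_ae ?_
        filter_upwards [hpos] with p hp
        have hf' : Measurable fun n => f (restart p.1 u, n) * (ρ {n})⁻¹ :=
          (by fun_prop : Measurable fun n => f (restart p.1 u, n)).mul hρ1.inv
        simp only [g, hgC, hu, if_false]
        rw [← lintegral_map hf' measurable_snd, ← hρ]
        calc f (restart p.1 u, p.2)
            = ∫⁻ n in {p.2}, f (restart p.1 u, n) * (ρ {n})⁻¹ ∂ρ := by
              rw [lintegral_singleton, mul_assoc, ENNReal.inv_mul_cancel hp (measure_ne_top _ _),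
                mul_one]
          _ ≤ _ := setLIntegral_le_lintegral _ _
      · have : Measurable fun z : ((A → I) × 𝓥) × ((A → I) × 𝓥) => (restart z.2.1 u, z.1.2) :=
          ((hr u).comp measurable_snd).prodMk measurable_fst.snd
        exact ((hf.comp this).mul (hg.comp this)).aemeasurable
  · have hm := measurable_neg_log_singleton ρ
    have hH : ∫⁻ p, (-ENNReal.log (ρ {p.2})).toENNReal ∂π ≤ F.card := by
      rw [← lintegral_map (f := fun n => (-ENNReal.log (ρ {n})).toENNReal) hm measurable_snd]
      exact lintegral_neg_log_le_card ρ hρF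
    calc ∫⁻ u, ∫⁻ p, (ENNReal.log (g (restart p.1 u, p.2))).toENNReal ∂π ∂P
        ≤ ∫⁻ u, ∑ a, {u : ℕ → A → I × Bool × I | (u 0 a).2.1 = false}.indicator
            (fun _ => (F.card : ℝ≥0∞)) u ∂P := by
          refine lintegral_mono fun u => ?_
          by_cases hu : ∀ a, (u 0 a).2.1 = true
          · simp [g, hgC, hu]
          · simp only [g, hgC, hu, if_false, ENNReal.log_inv]
            -- Union bound: one retained action pays for the whole history.
            push Not at hu
            obtain ⟨a, ha⟩ := hu
            refine hH.trans ?_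
            refine le_trans ?_ (Finset.single_le_sum (fun _ _ => zero_le) (Finset.mem_univ a))
            simp [Set.indicator, ha]
      _ = Fintype.card A * c * F.card := by
          rw [lintegral_finsetSum _ fun a _ => measurable_const.indicator (measurableSet_coin a)]
          simp_rw [lintegral_indicator_const (measurableSet_coin _), hP]
          simp [mul_assoc, mul_comm c]

end

/-! ### Rewards as functions of the driving variables -/

lemma meanReward_congr {w w' : ℕ × A → I × Bool × I} {t : ℕ}
    (h : ∀ p : ℕ × A, p.1 ≤ t → w p = w' p) : meanReward w t = meanReward w' t := by
  induction t with
  | zero => funext a; simp only [meanReward, h (0, a) le_rfl]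
  | succ t ih =>
    funext a
    simp only [meanReward, h (t + 1, a) le_rfl, ih fun p hp => h p (hp.trans t.le_succ)]

lemma reward_congr {w w' : ℕ × A → I × Bool × I} {t : ℕ}
    (h : ∀ p : ℕ × A, p.1 ≤ t → w p = w' p) : reward w t = reward w' t := by
  funext a
  simp only [reward, h (t, a) le_rfl, meanReward_congr h]

/-- The driving variables after timestep `t`. -/
def future (t : ℕ) (w : ℕ × A → I × Bool × I) (s : ℕ) (a : A) : I × Bool × I := w (t + 1 + s, a)

lemma restart_uniform (m : A → I) (u : ℕ → A → I × Bool × I) (p : ℕ × A) :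
    (restart m u p).2.2 = (u p.1 p.2).2.2 := by
  unfold restart
  split_ifs with h
  · rw [h.1]
  · rfl

/-- Time `0` after restarting is time `t + 1`. There `meanReward` ignores the coin, so `restart` has
already put the old mean in place of the fresh draw when the coin says to keep it. -/
lemma meanReward_restart (w : ℕ × A → I × Bool × I) (t s : ℕ) :
    meanReward (restart (meanReward w t) (future t w)) s = meanReward w (t + 1 + s) := by
  induction s with
  | zero =>
    funext a
    by_cases h : (w (t + 1, a)).2.1 = true <;> simp [meanReward, restart, future, h]
  | succ s ih =>
    funext a
    rw [← add_assoc]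
    simp only [meanReward, ih]
    simp [restart, future, add_assoc]

lemma reward_restart (w : ℕ × A → I × Bool × I) (t s : ℕ) :
    reward (restart (meanReward w t) (future t w)) s = reward w (t + 1 + s) := by
  funext a
  simp only [reward, meanReward_restart]
  rw [restart_uniform]
  rfl

lemma measurable_meanReward (t : ℕ) :
    Measurable fun w : ℕ × A → I × Bool × I => meanReward w t := by
  refine measurable_pi_lambda _ fun a => ?_
  induction t with
  | zero => simp only [meanReward]; fun_prop
  | succ t ih =>
    simp only [meanReward]
    exact Measurable.ite (measurableSet_eq_fun (by fun_prop) measurable_const) (by fun_prop) ih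

lemma measurable_reward (t : ℕ) : Measurable fun w : ℕ × A → I × Bool × I => reward w t := by
  refine measurable_pi_lambda _ fun a => ?_
  have := measurable_meanReward (A := A) t
  exact Measurable.ite (measurableSet_lt (by fun_prop) (by fun_prop)) measurable_const
    measurable_const

lemma measurable_future (t : ℕ) :
    Measurable (future t : (ℕ × A → I × Bool × I) → ℕ → A → I × Bool × I) :=
  measurable_pi_lambda _ fun _ => measurable_pi_lambda _ fun _ => measurable_pi_apply _

/-! ### Independence and stationarity under the driving law -/

section
variable (ν : A → Measure I) [∀ a, IsProbabilityMeasure (ν a)] (q : A → I)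

instance : IsProbabilityMeasure (drivingLaw ν q) := by
  unfold drivingLaw; infer_instance

lemma indepFun_past_future (t : ℕ) {β : Type*} [MeasurableSpace β]
    {Φ : (ℕ × A → I × Bool × I) → β} (hΦ : Measurable Φ)
    (hdep : ∀ w w', (∀ p : ℕ × A, p.1 ≤ t → w p = w' p) → Φ w = Φ w') :
    IndepFun Φ (future t) (drivingLaw ν q) := by
  have hi : iIndepFun (fun (p : ℕ × A) (w : ℕ × A → I × Bool × I) => w p) (drivingLaw ν q) :=
    iIndepFun_infinitePi (X := fun _ x => x) fun _ => measurable_id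
  have h := indep_iSup_of_disjoint (fun p => (measurable_pi_apply p).comap_le) hi.iIndep
    (S := {p | p.1 ≤ t}) (T := {p | t < p.1})
    (by simp [Set.disjoint_left])
  rw [IndepFun_iff_Indep]
  refine indep_of_indep_of_le_left (indep_of_indep_of_le_right h ?_) ?_
  · simp only [MeasurableSpace.pi, MeasurableSpace.comap_iSup, MeasurableSpace.comap_comp]
    refine iSup_le fun s => iSup_le fun a => ?_
    exact le_iSup₂_of_le (t + 1 + s, a) (by simp; omega) le_rfl
  -- Freezing the coordinates after `t` at an arbitrary value does not change `Φ`, so `Φ` is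
  -- measurable with respect to the earlier ones.
  · let tr : (ℕ × A → I × Bool × I) → ℕ × A → I × Bool × I := fun w p =>
      if p.1 ≤ t then w p else (0, false, 0)
    have e : Φ = Φ ∘ tr := funext fun w => hdep _ _ fun p hp => by simp [tr, hp]
    rw [e, ← MeasurableSpace.comap_comp]
    refine (MeasurableSpace.comap_mono hΦ.comap_le).trans ?_
    simp only [MeasurableSpace.pi, MeasurableSpace.comap_iSup, MeasurableSpace.comap_comp]
    refine iSup_le fun p => ?_
    by_cases hp : p.1 ≤ t
    · refine le_iSup₂_of_le p hp (le_of_eq ?_)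
      congr 1
      funext w
      simp [tr, hp]
    · have : (fun x => x p) ∘ tr = fun _ => (0, false, 0) := by
        funext w
        simp [tr, hp]
      rw [this, MeasurableSpace.comap_const]
      exact bot_le

lemma map_drivingLaw_slice [Fintype A] (t : ℕ) :
    (drivingLaw ν q).map (fun w (a : A) => w (t, a)) =
      Measure.pi fun a => (ν a).prod ((bernoulliMeasure true false (q a)).prod volume) := by
  rw [← Measure.infinitePi_eq_pi]
  exact Measure.map_infinitePi_infinitePi_of_inj (Prod.mk_right_injective t)

lemma drivingLaw_coin_false (p : ℕ × A) :
    drivingLaw ν q {w | (w p).2.1 = false} = ENNReal.ofReal (1 - (q p.2 : ℝ)) := by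
  have hs : MeasurableSet {x : I × Bool × I | x.2.1 = false} :=
    measurableSet_eq_fun (by fun_prop) measurable_const
  have h := Measure.infinitePi_map_eval (fun p : ℕ × A =>
    (ν p.2).prod ((bernoulliMeasure true false (q p.2)).prod (volume : Measure I))) p
  have h2 : drivingLaw ν q {w | (w p).2.1 = false} =
      ((drivingLaw ν q).map fun w => w p) {x | x.2.1 = false} :=
    (Measure.map_apply (f := fun w : ℕ × A → I × Bool × I => w p) (measurable_pi_apply p) hs).symm
  rw [h2, drivingLaw, h]
  have : {x : I × Bool × I | x.2.1 = false} = Set.univ ×ˢ ({false} ×ˢ Set.univ) := by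
    ext x; simp
  rw [this, Measure.prod_prod, Measure.prod_prod]
  simp only [measure_univ, one_mul, mul_one]
  classical
  rw [bernoulliMeasure_apply _ (measurableSet_singleton _)]
  simp only [Set.mem_singleton_iff, Bool.true_eq_false, if_false, if_true]
  rw [← ENNReal.ofReal_coe_nnreal]
  rfl

end

lemma map_redraw (Q : Measure I) [IsProbabilityMeasure Q] (q : I) :
    (Q.prod (Q.prod ((bernoulliMeasure true false q).prod (volume : Measure I)))).map
      (fun x => if x.2.2.1 = true then x.2.1 else x.1) = Q := by
  have hm : Measurable fun x : I × I × Bool × I => if x.2.2.1 = true then x.2.1 else x.1 :=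
    Measurable.ite (measurableSet_eq_fun (by fun_prop) measurable_const) (by fun_prop) (by fun_prop)
  ext s hs
  rw [Measure.map_apply hm hs]
  have : (fun x : I × I × Bool × I => if x.2.2.1 = true then x.2.1 else x.1) ⁻¹' s =
      Set.univ ×ˢ (s ×ˢ ({true} ×ˢ Set.univ)) ∪ s ×ˢ (Set.univ ×ˢ ({false} ×ˢ Set.univ)) := by
    ext ⟨x, y, b, u⟩
    cases b <;> simp
  rw [this, measure_union _ (by measurability)]
  · simp only [Measure.prod_prod, measure_univ, one_mul, mul_one]
    classical
    rw [mul_comm (Q s), mul_comm (Q s), ← add_mul, ← measure_union (by simp) (by measurability)]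
    have : ({true} ∪ {false} : Set Bool) = Set.univ := by ext b; cases b <;> simp
    rw [this, measure_univ, one_mul]
  · rw [Set.disjoint_left]
    rintro ⟨x, y, b, u⟩ h1 h2
    cases b <;> simp_all

/-- Stationarity: the slice at `t + 1` is independent of the current means, and `map_redraw` applies
action by action. -/
lemma map_meanReward [Fintype A] (Q : Measure I) [IsProbabilityMeasure Q] (q : I) (t : ℕ) :
    (drivingLaw (fun _ : A => Q) (fun _ => q)).map (fun w => meanReward w t) =
      Measure.pi fun _ => Q := by
  induction t with
  | zero =>
    have e : (fun w : ℕ × A → I × Bool × I => meanReward w 0) =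
        (fun x a => (x a).1) ∘ fun w a => w (0, a) := rfl
    rw [e, ← Measure.map_map (by fun_prop) (by fun_prop), map_drivingLaw_slice,
      Measure.pi_map_pi fun _ => by fun_prop]
    simp [Measure.map_fst_prod]
  | succ t ih =>
    have hind : IndepFun (fun w => meanReward w t) (fun w (a : A) => w (t + 1, a))
        (drivingLaw (fun _ : A => Q) (fun _ => q)) :=
      (indepFun_past_future _ _ t (measurable_meanReward t) fun _ _ => meanReward_congr).comp
        measurable_id (measurable_pi_apply 0)
    rw [indepFun_iff_map_prod_eq_prod_map_map (measurable_meanReward t).aemeasurable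
      (by fun_prop : Measurable fun (w : ℕ × A → I × Bool × I) (a : A) => w (t + 1, a)).aemeasurable,
      ih, map_drivingLaw_slice, ← (measurePreserving_arrowProdEquivProdArrow _ _ A _ _).map_eq]
      at hind
    have hm : Measurable fun x : I × I × Bool × I => if x.2.2.1 = true then x.2.1 else x.1 :=
      Measurable.ite (measurableSet_eq_fun (by fun_prop) measurable_const) (by fun_prop)
        (by fun_prop)
    let F : (A → I) × (A → I × Bool × I) → A → I := fun x a =>
      if (x.2 a).2.1 = true then (x.2 a).1 else x.1 a
    have hF : Measurable F := measurable_pi_lambda _ fun a => hm.comp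
      (by fun_prop : Measurable fun x : (A → I) × (A → I × Bool × I) => (x.1 a, x.2 a))
    have e : (fun w : ℕ × A → I × Bool × I => meanReward w (t + 1)) =
        F ∘ fun w => (meanReward w t, fun a => w (t + 1, a)) := rfl
    rw [e, ← Measure.map_map hF ((measurable_meanReward t).prodMk (by fun_prop)), hind,
      Measure.map_map hF (MeasurableEquiv.measurable _)]
    have e2 : F ∘ (MeasurableEquiv.arrowProdEquivProdArrow I (I × Bool × I) A) =
        fun x a => if (x a).2.2.1 = true then (x a).2.1 else (x a).1 := rfl
    rw [e2]
    have h1 := Measure.isProbabilityMeasure_map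
      (μ := Q.prod (Q.prod ((bernoulliMeasure true false q).prod (volume : Measure I))))
      hm.aemeasurable
    rw [Measure.pi_map_pi (f := fun _ (x : I × I × Bool × I) =>
      if x.2.2.1 = true then x.2.1 else x.1) fun _ => hm.aemeasurable]
    simp only [map_redraw]

/-! ### Reduction of predictive information to restarted variables -/

/-- Rewards up to and including timestep `t`, the last one kept apart. -/
noncomputable def pastRewards (t : ℕ) (w : ℕ × A → I × Bool × I) : (Fin t → A → ℝ) × (A → ℝ) :=
  (fun i => reward w i, reward w t)

lemma measurable_pastRewards (t : ℕ) :
    Measurable (pastRewards t : (ℕ × A → I × Bool × I) → _) :=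
  (measurable_pi_lambda _ fun i : Fin t => measurable_reward (i : ℕ)).prodMk (measurable_reward t)

/-- The joint law of the mean rewards at timestep `t` and the rewards up to then. -/
noncomputable def pastLaw (D : Measure (ℕ × A → I × Bool × I)) (t : ℕ) :
    Measure ((A → I) × ((Fin t → A → ℝ) × (A → ℝ))) :=
  D.map fun w => (meanReward w t, pastRewards t w)

lemma measurable_past (t : ℕ) : Measurable fun w : ℕ × A → I × Bool × I =>
    (meanReward w t, pastRewards t w) :=
  (measurable_meanReward t).prodMk (measurable_pastRewards t)

instance (D : Measure (ℕ × A → I × Bool × I)) [IsProbabilityMeasure D] (t : ℕ) :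
    IsProbabilityMeasure (pastLaw D t) :=
  Measure.isProbabilityMeasure_map (measurable_past t).aemeasurable

lemma pastLaw_prod_future (ν : A → Measure I) [∀ a, IsProbabilityMeasure (ν a)] (q : A → I)
    (t : ℕ) :
    (pastLaw (drivingLaw ν q) t).prod ((drivingLaw ν q).map (future t)) =
      (drivingLaw ν q).map fun w => ((meanReward w t, pastRewards t w), future t w) := by
  refine ((indepFun_iff_map_prod_eq_prod_map_map (measurable_past t).aemeasurable
    (measurable_future t).aemeasurable).1 ?_).symm
  refine indepFun_past_future ν q t (measurable_past t) fun w w' h => ?_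
  simp only [pastRewards, Prod.mk.injEq]
  exact ⟨meanReward_congr h, funext fun i => reward_congr fun p hp => h p (hp.trans i.2.le),
    reward_congr h⟩

/-- The law of a functional of the rewards may be computed on the driving variables. -/
lemma map_reward_eq {Ω : Type*} [MeasurableSpace Ω] {μ : Measure Ω}
    {θ : ℕ → Ω → A → I} {R : ℕ → Ω → A → ℝ}
    {ν : A → Measure I} [∀ a, IsProbabilityMeasure (ν a)] {q : A → I}
    (hR : IsModulatedBernoulliBandit μ θ R ν q) {β : Type*} [MeasurableSpace β]
    {Φ : (ℕ → A → ℝ) → β} (hΦ : Measurable Φ) :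
    μ.map (fun ω => Φ fun t => R t ω) = (drivingLaw ν q).map fun w => Φ fun t => reward w t := by
  have hRm := hR.measurable_reward
  have hlaw : μ.map (fun ω t => R t ω) = (drivingLaw ν q).map fun w t => reward w t := by
    have hp : Measurable fun (x : ℕ → A → I × ℝ) (t : ℕ) (a : A) => (x t a).2 := by fun_prop
    have h1 : Measurable fun (ω : Ω) (t : ℕ) (a : A) => (θ t ω a, R t ω a) :=
      measurable_pi_lambda _ fun t => measurable_pi_lambda _ fun a =>
        ((measurable_pi_apply a).comp (hR.measurable_mean t)).prodMk
          ((measurable_pi_apply a).comp (hRm t))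
    have h2 : Measurable fun (w : ℕ × A → I × Bool × I) (t : ℕ) (a : A) =>
        (meanReward w t a, reward w t a) :=
      measurable_pi_lambda _ fun t => measurable_pi_lambda _ fun a =>
        ((measurable_pi_apply a).comp (measurable_meanReward t)).prodMk
          ((measurable_pi_apply a).comp (measurable_reward t))
    have h := congrArg (fun m => m.map fun (x : ℕ → A → I × ℝ) (t : ℕ) (a : A) => (x t a).2) hR.law
    simp only [Measure.map_map hp h1, Measure.map_map hp h2] at h
    exact h
  have h := congrArg (fun m => m.map Φ) hlaw
  rw [Measure.map_map hΦ (measurable_pi_lambda _ hRm),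
    Measure.map_map hΦ (measurable_pi_lambda _ measurable_reward)] at h
  exact h

/-- Data processing: the later targets are the image under `Ψ` of the restarted variables. -/
lemma incrementalPredictiveInfo_le [Fintype A] {Ω : Type*} [MeasurableSpace Ω] {μ : Measure Ω}
    [IsProbabilityMeasure μ] {θ : ℕ → Ω → A → I} {R : ℕ → Ω → A → ℝ}
    {ν : A → Measure I} [∀ a, IsProbabilityMeasure (ν a)] {q : A → I}
    (hR : IsModulatedBernoulliBandit μ θ R ν q)
    {E : ℕ → Type*} [∀ t, MeasurableSpace (E t)] {f : ∀ t, (A → ℝ) → E t}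
    (hf : ∀ t, Measurable (f t)) (t : ℕ) :
    incrementalPredictiveInfo μ (fun t ω => f t (R t ω)) R t ≤
      klDiv (((pastLaw (drivingLaw ν q) t).prod ((drivingLaw ν q).map (future t))).map
          fun x => (restart x.1.1 x.2, x.1.2))
        ((((pastLaw (drivingLaw ν q) t).prod ((drivingLaw ν q).map (future t))).map
          fun x => restart x.1.1 x.2).prod ((pastLaw (drivingLaw ν q) t).map Prod.snd)) := by
  set D := drivingLaw ν q with hD
  have hRm := hR.measurable_reward
  have hsm : Measurable fun x : ((A → I) × ((Fin t → A → ℝ) × (A → ℝ))) ×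
      (ℕ → A → I × Bool × I) => restart x.1.1 x.2 :=
    measurable_restart.comp (measurable_fst.fst.prodMk measurable_snd)
  have hjoint : Measurable fun w : ℕ × A → I × Bool × I =>
      ((meanReward w t, pastRewards t w), future t w) :=
    (measurable_past t).prodMk (measurable_future t)
  let X : (ℕ → A → ℝ) → ∀ i, E (t + 1 + i) := fun r i => f (t + 1 + i) (r (t + 1 + i))
  let N : (ℕ → A → ℝ) → (Fin t → A → ℝ) × (A → ℝ) := fun r => (fun i => r i, r t)
  have hX : Measurable X := measurable_pi_lambda _ fun i => (hf _).comp (measurable_pi_apply _)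
  have hN : Measurable N := by fun_prop
  let Ψ : (ℕ × A → I × Bool × I) → ∀ i, E (t + 1 + i) := fun w i => f (t + 1 + i) (reward w i)
  have hΨ : Measurable Ψ := measurable_pi_lambda _ fun i => (hf _).comp (measurable_reward i)
  have hXΨ : ∀ w, X (fun t => reward w t) = Ψ (restart (meanReward w t) (future t w)) := by
    intro w
    funext i
    simp only [X, Ψ, reward_restart]
  have := Measure.isProbabilityMeasure_map (μ := D) (measurable_future t).aemeasurable
  have := Measure.isProbabilityMeasure_map (μ := (pastLaw D t).prod (D.map (future t)))
    hsm.aemeasurable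
  have := Measure.isProbabilityMeasure_map (μ := pastLaw D t) measurable_snd.aemeasurable
  refine (condMutualInfo_le μ (X := fun ω => X fun t => R t ω) (Y := R t)
    (Z := fun ω (i : Fin t) => R i ω) (hX.comp (measurable_pi_lambda _ hRm)) (hRm t)
    (measurable_pi_lambda _ fun i => hRm i)).trans ?_
  have e1 : μ.map (fun ω => (X fun t => R t ω, ((fun i : Fin t => R i ω), R t ω))) =
      (((pastLaw D t).prod (D.map (future t))).map fun x => (restart x.1.1 x.2, x.1.2)).map
        (Prod.map Ψ id) := by
    rw [Measure.map_map (hΨ.prodMap measurable_id) (by fun_prop), pastLaw_prod_future,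
      Measure.map_map ((hΨ.prodMap measurable_id).comp (by fun_prop)) hjoint]
    refine (map_reward_eq hR (hX.prodMk hN)).trans (congrArg (fun F => D.map F) (funext fun w => ?_))
    simp only [hXΨ, Function.comp_apply, Prod.map_apply, id_eq]
    rfl
  have e2 : μ.map (fun ω => X fun t => R t ω) =
      (((pastLaw D t).prod (D.map (future t))).map fun x => restart x.1.1 x.2).map Ψ := by
    rw [Measure.map_map hΨ hsm, pastLaw_prod_future, Measure.map_map (hΨ.comp hsm) hjoint]
    exact (map_reward_eq hR hX).trans (congrArg (fun F => D.map F) (funext hXΨ))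
  have e3 : μ.map (fun ω => ((fun i : Fin t => R i ω), R t ω)) =
      ((pastLaw D t).map Prod.snd).map id := by
    rw [Measure.map_id, pastLaw, Measure.map_map measurable_snd (measurable_past t)]
    exact map_reward_eq hR hN
  rw [e1, e2, e3, Measure.map_prod_map _ _ hΨ measurable_id]
  exact klDiv_map_le _ _ (hΨ.prodMap measurable_id)

lemma future_coin_false (Q : Measure I) [IsProbabilityMeasure Q] (q : I) (t : ℕ) (a : A) :
    (drivingLaw (fun _ : A => Q) fun _ => q).map (future t) {u | (u 0 a).2.1 = false} =
      ENNReal.ofReal (1 - (q : ℝ)) := by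
  rw [Measure.map_apply (measurable_future t) (measurableSet_coin a)]
  exact drivingLaw_coin_false (fun _ => Q) (fun _ => q) (t + 1, a)

/-! ### The two bounds per timestep, and limits -/

section
variable [Fintype A] {Q : Measure I} [IsProbabilityMeasure Q] {q : I}
  {Ω : Type*} [MeasurableSpace Ω] {μ : Measure Ω} [IsProbabilityMeasure μ]
  {θ : ℕ → Ω → A → I} {R : ℕ → Ω → A → ℝ}
  {E : ℕ → Type*} [∀ t, MeasurableSpace (E t)] {f : ∀ t, (A → ℝ) → E t}

lemma incrementalPredictiveInfo_le_entropy
    (hR : IsModulatedBernoulliBandit μ θ R (fun _ => Q) fun _ => q)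
    (hf : ∀ t, Measurable (f t)) (t : ℕ) :
    incrementalPredictiveInfo μ (fun t ω => f t (R t ω)) R t ≤
      Fintype.card A * ENNReal.ofReal (1 - (q : ℝ)) * entropy Q := by
  have := Measure.isProbabilityMeasure_map (μ := drivingLaw (fun _ : A => Q) fun _ => q)
    (measurable_future t).aemeasurable
  refine (incrementalPredictiveInfo_le hR hf t).trans
    (klDiv_restart_le_entropy _ _ ?_ (future_coin_false Q q t))
  rw [pastLaw, Measure.map_map measurable_fst (measurable_past t)]
  exact map_meanReward Q q t

variable (A) in
/-- The possible values of the rewards up to a timestep. -/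
noncomputable def rewardValues (t : ℕ) : Finset ((Fin t → A → ℝ) × (A → ℝ)) := by
  classical
  exact Finset.univ.image fun b : (Fin t → A → Bool) × (A → Bool) =>
    (fun i a => if b.1 i a then 1 else 0, fun a => if b.2 a then 1 else 0)

lemma pastRewards_mem (t : ℕ) (w : ℕ × A → I × Bool × I) :
    pastRewards t w ∈ rewardValues A t := by
  classical
  simp only [rewardValues, Finset.mem_image, Finset.mem_univ, true_and]
  refine ⟨(fun i a => decide ((w (i, a)).2.2 < meanReward w i a),
    fun a => decide ((w (t, a)).2.2 < meanReward w t a)), ?_⟩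
  simp only [pastRewards, decide_eq_true_eq]
  rfl

lemma incrementalPredictiveInfo_le_card
    (hR : IsModulatedBernoulliBandit μ θ R (fun _ => Q) fun _ => q)
    (hf : ∀ t, Measurable (f t)) (t : ℕ) :
    incrementalPredictiveInfo μ (fun t ω => f t (R t ω)) R t ≤
      Fintype.card A * ENNReal.ofReal (1 - (q : ℝ)) * (rewardValues A t).card := by
  have := Measure.isProbabilityMeasure_map (μ := drivingLaw (fun _ : A => Q) fun _ => q)
    (measurable_future t).aemeasurable
  refine (incrementalPredictiveInfo_le hR hf t).trans
    (klDiv_restart_le_card _ _ ?_ (future_coin_false Q q t))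
  rw [pastLaw, Measure.map_apply (measurable_past t)
    (measurable_snd (rewardValues A t).measurableSet.compl)]
  convert measure_empty (μ := drivingLaw (fun _ : A => Q) fun _ => q)
  ext w
  simp [pastRewards_mem]

end

lemma tendsto_ofReal_one_sub {q : ℕ → I} (hq : Tendsto q atTop (𝓝 1)) :
    Tendsto (fun k => ENNReal.ofReal (1 - (q k : ℝ))) atTop (𝓝 0) := by
  have h : Tendsto (fun k => (q k : ℝ)) atTop (𝓝 1) := (continuous_subtype_val.tendsto 1).comp hq
  simpa using ENNReal.tendsto_ofReal (h.const_sub 1)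

lemma tendsto_mul_mul_zero {c : ℕ → ℝ≥0∞} (hc : Tendsto c atTop (𝓝 0)) {a b : ℝ≥0∞} (ha : a ≠ ∞)
    (hb : b ≠ ∞) : Tendsto (fun k => a * c k * b) atTop (𝓝 0) := by
  simpa using ENNReal.Tendsto.mul_const (ENNReal.Tendsto.const_mul hc (Or.inr ha)) (Or.inr hb)

end ModulatedBandit

theorem proposition1 {A : Type*} [Fintype A]
    (Q : Measure I) [IsProbabilityMeasure Q]
    (q : ℕ → I) (hq_mono : Monotone q) (hq_lim : Tendsto q atTop (𝓝 1))
    {Ω : ℕ → Type*} [∀ k, MeasurableSpace (Ω k)]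
    (μ : ∀ k, Measure (Ω k)) [∀ k, IsProbabilityMeasure (μ k)]
    (θ : ∀ k, ℕ → Ω k → A → I) (R : ∀ k, ℕ → Ω k → A → ℝ)
    (hR : ∀ k, ModulatedBandit.IsModulatedBernoulliBandit (μ k) (θ k) (R k)
      (fun _ => Q) (fun _ => q k))
    {E : ℕ → Type*} [∀ t, MeasurableSpace (E t)]
    (f : ∀ t, (A → ℝ) → E t) (hf : ∀ t, Measurable (f t)) (T : ℕ) :
    (∀ k, ModulatedBandit.cumulativePredictiveInfo (μ k) (fun t ω => f t (R k t ω)) (R k) T ≤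
      (T : ℝ≥0∞) * (Fintype.card A : ℝ≥0∞) * ENNReal.ofReal (1 - (q k : ℝ)) *
        ModulatedBandit.entropy Q) ∧
    (ModulatedBandit.entropy Q ≠ ∞ →
      Tendsto (fun k => (T : ℝ≥0∞) * (Fintype.card A : ℝ≥0∞) * ENNReal.ofReal (1 - (q k : ℝ)) *
        ModulatedBandit.entropy Q) atTop (𝓝 0)) ∧
    Tendsto (fun k => ModulatedBandit.cumulativePredictiveInfo (μ k)
      (fun t ω => f t (R k t ω)) (R k) T) atTop (𝓝 0) := by
  have hq0 := ModulatedBandit.tendsto_ofReal_one_sub hq_lim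
  refine ⟨fun k => ?_, fun hH => ?_, ?_⟩
  · refine (Finset.sum_le_card_nsmul _ _ _ fun t _ =>
      ModulatedBandit.incrementalPredictiveInfo_le_entropy (hR k) hf t).trans_eq ?_
    simp [mul_assoc]
  · exact ModulatedBandit.tendsto_mul_mul_zero hq0
      (ENNReal.mul_ne_top (ENNReal.natCast_ne_top _) (ENNReal.natCast_ne_top _)) hH
  -- The cardinality bound depends on `t` but not on `k` apart from `1 - q k`, and the sum has `T`
  -- terms.
  · rw [← Finset.sum_const_zero (s := Finset.range T)]
    refine tendsto_finsetSum _ fun t _ => ?_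
    exact tendsto_of_tendsto_of_tendsto_of_le_of_le tendsto_const_nhds
      (ModulatedBandit.tendsto_mul_mul_zero hq0 (ENNReal.natCast_ne_top _)
        (ENNReal.natCast_ne_top _)) (fun _ => zero_le)
      fun k => ModulatedBandit.incrementalPredictiveInfo_le_card (hR k) hf t
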